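/- **Theorem (Strong Consistency).** Let $\mathcal G$ be a connected undirected simple graph on a finite non-empty set $\mathcal V$ of $N$ agents, and let $\mathcal N_i$ be the set of neighbours of agent $i$. Let $\theta\in\mathbb R^n$, $H_i\in\mathbb R^{m_i\times n}$ and $$y_i(t)=H_i\theta+v_i(t),\qquad i\in\mathcal V,\ t=0,1,2,\dots,$$ where, for each $i$, the random vectors $(v_i(t))_{t\ge0}$ in $\mathbb R^{m_i}$ are i.i.d. with mean zero (the noises of different agents may be correlated). Assume 1. $\sum_{i\in\mathcal V}H_i^TH_i$ has full rank $n$; 2. there is $\epsilon_1>0$ with $\mathbb E\|V(t)\|^{2+\epsilon_1}<\infty$ for all $t$, where $V(t)=[v_1(t)^T,\dots,v_N(t)^T]^T$ and $\|\cdot\|$ is the Euclidean norm; 3. $\alpha(t)=\frac{a}{(t+1)^{\tau_1}}$ and $\beta(t)=\frac{b}{(t+1)^{\tau_2}}$ with $a,b>0$, $0<\tau_2\le\tau_1\le1$ and $\tau_1>\max\{\tau_2+\frac1{2+\epsilon_1},\frac12\}$. Let $\rho_i>0$ for $i\in\mathcal V$ and $\rho_0=\min_{i}\rho_i$. Each agent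 $i$ has an estimate $x_i(t)\in\mathbb R^n$ with arbitrary (possibly random) initial value $x_i(0)$. Agent $i$ sends its estimate to its neighbours at time $0$, and then at every time $t\ge1$ at which $\|x_i(t)-x_i(s)\|>(t+1)^{-\rho_i}$, where $s<t$ is its latest sending time before $t$. Put $\gamma_i(t)=0$ if agent $i$ sends at time $t$ and $\gamma_i(t)=1$ otherwise, and let $t^i_k=t^i_k(t)$ be the latest sending time of agent $i$ that is $\le t$. Let the estimates be given by $$x_i(t+1)=x_i(t)+\alpha(t)H_i^T\bigl(y_i(t)-H_ix_i(t)\bigr)+\beta(t)\sum_{j\in\mathcal N_i}\bigl(\gamma_i(t)x_j(t^j_k)+(1-\gamma_i(t))x_j(t)-x_i(t)\bigr)\quad(i\in\mathcal V,\ t\ge 0),$$ or by $$x_i(t+1)=x_i(t)+\beta(t)\sum_{j\in\mathcal N_i}\bigl(x_j(t)-x_i(t)\bigr)+\alpha(t)H_i^T\bigl(y_i(t)-H_ix_i(t)\bigr)+\beta(t)\sum_{j\in\mathcal N_i}\bigl(x_j(t^j_k)-x_j(t)\bigr)\quad(i\in\mathcal V,\ t\ge 0).$$ In either case, if $\rho_0>\tau_1-\tau_2$,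 then $$\mathbb P\Bigl(\lim_{t\to\infty}x_i(t)=\theta\Bigr)=1\qquad\text{for all } i\in\mathcal V.$$ -/

import Mathlib

open MeasureTheory ProbabilityTheory Filter Topology

noncomputable section

/-- Polynomially decaying coefficient `c / (t + 1) ^ τ`. -/
def polyStep (c τ : ℝ) (t : ℕ) : ℝ := c / ((t : ℝ) + 1) ^ τ

/-- Action of a real matrix on a Euclidean vector, `A x`. -/
def matAct {p q : ℕ} (A : Matrix (Fin p) (Fin q) ℝ) (x : EuclideanSpace ℝ (Fin q)) :
    EuclideanSpace ℝ (Fin p) :=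
  WithLp.toLp 2 (A.mulVec x.ofLp)

open Classical in
/-- The latest triggering instant `≤ t` of an agent with trajectory `x` and threshold
`1 / (t + 1) ^ ρ`.  Every agent sends its initial estimate, so the first triggering instant
is `0`; at a later time `t` the agent triggers iff `x t` differs from the estimate sent last
before `t` by more than the threshold. -/
def latestTrigger {n : ℕ} (ρ : ℝ) (x : ℕ → EuclideanSpace ℝ (Fin n)) : ℕ → ℕ
  | 0 => 0
  | t + 1 =>
      if ‖x (t + 1) - x (latestTrigger ρ x t)‖ > polyStep 1 ρ (t + 1) then t + 1
      else latestTrigger ρ x t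

/-- The triggering event at time `t`: the initial transmission for `t = 0`, and for `t + 1` the
comparison of the current estimate with the latest one sent before. -/
def TriggerEvent {n : ℕ} (ρ : ℝ) (x : ℕ → EuclideanSpace ℝ (Fin n)) : ℕ → Prop
  | 0 => True
  | t + 1 => ‖x (t + 1) - x (latestTrigger ρ x t)‖ > polyStep 1 ρ (t + 1)

open Classical in
/-- The indicator `γ`: it is `0` if the triggering event occurs and `1` otherwise. -/
def triggerIndicator {n : ℕ} (ρ : ℝ) (x : ℕ → EuclideanSpace ℝ (Fin n)) (t : ℕ) : ℝ :=
  if TriggerEvent ρ x t then 0 else 1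

/-- The observation `y = H θ + v`. -/
def observe {n p : ℕ} (H : Matrix (Fin p) (Fin n) ℝ) (θ : EuclideanSpace ℝ (Fin n))
    (v : EuclideanSpace ℝ (Fin p)) : EuclideanSpace ℝ (Fin p) :=
  matAct H θ + v

/-- The event-triggered estimator: agent `i` uses, for each neighbour `j`,
`γ_i(t) x_j(t_k^j) + (1 - γ_i(t)) x_j(t)`. -/
def IsEventTriggeredEstimator {V : Type*} [Fintype V] (𝒢 : SimpleGraph V)
    [DecidableRel 𝒢.Adj] {n : ℕ} {m : V → ℕ} (H : ∀ i, Matrix (Fin (m i)) (Fin n) ℝ)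
    (α β : ℕ → ℝ) (ρ : V → ℝ) (y : ∀ i, ℕ → EuclideanSpace ℝ (Fin (m i)))
    (x : V → ℕ → EuclideanSpace ℝ (Fin n)) : Prop :=
  ∀ i t, x i (t + 1) =
    x i t + α t • matAct (H i).transpose (y i t - matAct (H i) (x i t)) +
      β t • ∑ j ∈ 𝒢.neighborFinset i,
        (triggerIndicator (ρ i) (x i) t • x j (latestTrigger (ρ j) (x j) t) +
          (1 - triggerIndicator (ρ i) (x i) t) • x j t - x i t)

/-- The rewritten form of the event-triggered estimator: agent `i` uses, for each neighbour `j`,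
the estimate `x_j(t_k^j)` that `j` has sent last. -/
def IsEventTriggeredEstimatorStored {V : Type*} [Fintype V] (𝒢 : SimpleGraph V)
    [DecidableRel 𝒢.Adj] {n : ℕ} {m : V → ℕ} (H : ∀ i, Matrix (Fin (m i)) (Fin n) ℝ)
    (α β : ℕ → ℝ) (ρ : V → ℝ) (y : ∀ i, ℕ → EuclideanSpace ℝ (Fin (m i)))
    (x : V → ℕ → EuclideanSpace ℝ (Fin n)) : Prop :=
  ∀ i t, x i (t + 1) =
    x i t + β t • ∑ j ∈ 𝒢.neighborFinset i, (x j t - x i t) +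
      α t • matAct (H i).transpose (y i t - matAct (H i) (x i t)) +
      β t • ∑ j ∈ 𝒢.neighborFinset i, (x j (latestTrigger (ρ j) (x j) t) - x j t)

/-- The stacked noise vector `V(t) = [v_1(t)ᵀ, …, v_N(t)ᵀ]ᵀ`, with its Euclidean norm. -/
def stackNoise {V : Type*} {m : V → ℕ} (v : ∀ i, EuclideanSpace ℝ (Fin (m i))) :
    PiLp 2 (fun i => EuclideanSpace ℝ (Fin (m i))) :=
  WithLp.toLp 2 v

end

/-! Both algorithms are consensus plus innovations with a communication error of size at most `(t +
1) ^ (-ρ j)` from each neighbour `j`. Relative to the innovation step `α` it has order `(t + 1) ^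
(τ₁ - τ₂ - ρ j)`, which vanishes because `ρ₀ > τ₁ - τ₂`.

The stacked error is driven by the Laplacian with step `β` and by the observation operator with the
smaller step `α`. Connectedness and the rank condition leave these two no common kernel, so the
error contracts by `1 - c α` (`exists_norm_sub_adjoint_le`), and `∑ α = ∞` absorbs every
perturbation that is `o(α)`.

The noise is not `o(α)`, so it is first carried by an auxiliary process
(`tendsto_zero_of_two_scale_recursion`). Its network average has a convergent `α`-weighted series,
since `τ₁ > 1/2`. Its disagreement part is damped at the faster rate `β`, and the moment of order `2
+ ε₁` with `τ₁ - τ₂ > 1 / (2 + ε₁)` makes `(α / β) v` vanish almost surely. Subtracting this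
process, which tends to zero, leaves a noise-free contracting recursion. -/

/-- A nonnegative sequence with `u (t + 1) ≤ (1 - c s t) u t + s t ε t` tends to zero when the
steps `s` tend to zero with divergent sum and `ε` tends to zero. -/
theorem tendsto_zero_of_le_contraction {u s ε : ℕ → ℝ} {c : ℝ} (hc : 0 < c)
    (hu : ∀ t, 0 ≤ u t) (hs0 : ∀ t, 0 ≤ s t) (hs : Tendsto s atTop (𝓝 0))
    (hsum : ¬ Summable s) (hε : Tendsto ε atTop (𝓝 0))
    (h : ∀ᶠ t in atTop, u (t + 1) ≤ (1 - c * s t) * u t + s t * ε t) :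
    Tendsto u atTop (𝓝 0) := by
  rw [Metric.tendsto_atTop']
  intro r hr
  have h1 : ∀ᶠ t in atTop, s t < 1 / c := hs.eventually_lt_const (by positivity)
  have h2 : ∀ᶠ t in atTop, ε t < c * (r / 2) := hε.eventually_lt_const (by positivity)
  obtain ⟨T, hT⟩ := eventually_atTop.1 (h.and (h1.and h2))
  -- `r / 2` is the fixed point of the affine map `u ↦ (1 - c s) u + s c (r / 2)`; the excess over
  -- it shrinks by `1 - c s ≤ exp (-c s)` at each step.
  have key : ∀ k, u (k + T) ≤
      r / 2 + Real.exp (-(c * ∑ i ∈ Finset.range k, s (i + T))) * u T := by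
    intro k
    induction k with
    | zero => simp; positivity
    | succ k ih =>
      obtain ⟨a1, a2, a3⟩ := hT (k + T) (by omega)
      have hcs : c * s (k + T) ≤ 1 := by
        rw [lt_div_iff₀ hc] at a2
        linarith
      have e1 : k + 1 + T = k + T + 1 := by ring
      rw [e1, Finset.sum_range_succ, mul_add, neg_add, Real.exp_add]
      set E := Real.exp (-(c * ∑ i ∈ Finset.range k, s (i + T))) with hE
      have hexp : 1 - c * s (k + T) ≤ Real.exp (-(c * s (k + T))) := by
        have := Real.add_one_le_exp (-(c * s (k + T)))
        linarith
      have hEu : 0 ≤ E * u T := mul_nonneg (Real.exp_pos _).le (hu T)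
      calc u (k + T + 1) ≤ (1 - c * s (k + T)) * u (k + T) + s (k + T) * ε (k + T) := a1
        _ ≤ (1 - c * s (k + T)) * (r / 2 + E * u T) + s (k + T) * (c * (r / 2)) :=
            add_le_add (mul_le_mul_of_nonneg_left ih (by linarith))
              (mul_le_mul_of_nonneg_left a3.le (hs0 _))
        _ = r / 2 + (1 - c * s (k + T)) * (E * u T) := by ring
        _ ≤ r / 2 + Real.exp (-(c * s (k + T))) * (E * u T) := by gcongr
        _ = _ := by ring
  have hdiv : Tendsto (fun k => ∑ i ∈ Finset.range k, s (i + T)) atTop atTop := by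
    refine (not_summable_iff_tendsto_nat_atTop_of_nonneg fun i => hs0 _).1 ?_
    rwa [summable_nat_add_iff T]
  have hlim : Tendsto (fun k => Real.exp (-(c * ∑ i ∈ Finset.range k, s (i + T))) * u T)
      atTop (𝓝 0) := by
    simpa using ((Real.tendsto_exp_neg_atTop_nhds_zero.comp
      (hdiv.const_mul_atTop hc)).mul_const (u T))
  obtain ⟨K, hK⟩ := eventually_atTop.1 (hlim.eventually_lt_const (half_pos hr))
  refine ⟨K + T, fun t ht => ?_⟩
  obtain ⟨k, rfl⟩ : ∃ k, t = k + T := ⟨t - T, by omega⟩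
  rw [Real.dist_eq, sub_zero, abs_of_nonneg (hu _)]
  have := hK k (by omega)
  have := key k
  linarith

/-! ### Contracting and two-time-scale recursions in inner product spaces. -/

section Recursion

open ContinuousLinearMap

variable {E F₁ F₂ F₃ : Type*}
  [NormedAddCommGroup E] [InnerProductSpace ℝ E] [FiniteDimensional ℝ E] [CompleteSpace E]
  [NormedAddCommGroup F₁] [InnerProductSpace ℝ F₁] [CompleteSpace F₁]
  [NormedAddCommGroup F₂] [InnerProductSpace ℝ F₂] [CompleteSpace F₂]
  [NormedAddCommGroup F₃] [InnerProductSpace ℝ F₃] [CompleteSpace F₃]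

/-- If `T₁` and `T₂` have no common kernel, then `1 - s₁ T₁† T₁ - s₂ T₂† T₂` contracts by a factor
`1 - c s₂`, uniformly in small steps `s₂ ≤ s₁`. -/
theorem exists_norm_sub_adjoint_le (T₁ : E →L[ℝ] F₁) (T₂ : E →L[ℝ] F₂)
    (hker : ∀ z, T₁ z = 0 → T₂ z = 0 → z = 0) :
    ∃ c > 0, ∃ δ > 0, ∀ s₁ s₂ : ℝ, 0 ≤ s₂ → s₂ ≤ s₁ → s₁ ≤ δ → ∀ z,
      ‖z - s₁ • adjoint T₁ (T₁ z) - s₂ • adjoint T₂ (T₂ z)‖ ≤ (1 - c * s₂) * ‖z‖ := by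
  -- In finite dimension an injective linear map is bounded below; `K` is the inverse of that bound.
  obtain ⟨K, hK, hanti⟩ := (T₁.prod T₂ : E →L[ℝ] F₁ × F₂).toLinearMap.exists_antilipschitzWith
    (by
      rw [LinearMap.ker_eq_bot']
      intro z hz
      have hz' : (T₁ z, T₂ z) = (0, 0) := hz
      rw [Prod.mk.injEq] at hz'
      exact hker z hz'.1 hz'.2)
  have hK' : (0 : ℝ) < K := hK
  have hbound : ∀ z, ‖z‖ ^ 2 ≤ (K : ℝ) ^ 2 * (‖T₁ z‖ ^ 2 + ‖T₂ z‖ ^ 2) := by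
    intro z
    have h1 : ‖z‖ ≤ K * ‖(T₁ z, T₂ z)‖ := by
      have := hanti.le_mul_dist z 0
      simpa [dist_eq_norm] using this
    have h2 : ‖(T₁ z, T₂ z)‖ ^ 2 ≤ ‖T₁ z‖ ^ 2 + ‖T₂ z‖ ^ 2 := by
      rw [Prod.norm_mk]
      rcases max_cases ‖T₁ z‖ ‖T₂ z‖ with ⟨h, -⟩ | ⟨h, -⟩ <;> rw [h] <;>
        nlinarith [sq_nonneg ‖T₁ z‖, sq_nonneg ‖T₂ z‖]
    calc ‖z‖ ^ 2 ≤ (K * ‖(T₁ z, T₂ z)‖) ^ 2 := by gcongr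
      _ = (K : ℝ) ^ 2 * ‖(T₁ z, T₂ z)‖ ^ 2 := by ring
      _ ≤ _ := by gcongr
  set M : ℝ := max ‖adjoint T₁‖ ‖adjoint T₂‖ + 1 with hM
  have hM0 : 0 < M := by positivity
  have hMT₁ : ∀ w, ‖adjoint T₁ w‖ ≤ M * ‖w‖ := fun w =>
    (le_opNorm _ _).trans (by gcongr; linarith [le_max_left ‖adjoint T₁‖ ‖adjoint T₂‖])
  have hMT₂ : ∀ w, ‖adjoint T₂ w‖ ≤ M * ‖w‖ := fun w =>
    (le_opNorm _ _).trans (by gcongr; linarith [le_max_right ‖adjoint T₁‖ ‖adjoint T₂‖])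
  -- With `w` the total displacement, `s₁ ≤ 1 / (2 M²)` gives `‖w‖² ≤ ⟪z, w⟫`, hence `‖z - w‖² ≤
  -- ‖z‖² - ⟪z, w⟫ ≤ (1 - s₂ / K²) ‖z‖²`, and a square root halves the rate. The bound `2 K²` keeps
  -- `1 - c s₂` nonnegative.
  refine ⟨1 / (2 * (K : ℝ) ^ 2), by positivity, min (1 / (2 * M ^ 2)) (2 * (K : ℝ) ^ 2),
    by positivity, fun s₁ s₂ h0 h12 hδ z => ?_⟩
  have hδ₁ : 2 * M ^ 2 * s₁ ≤ 1 := by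
    have := hδ.trans (min_le_left _ _)
    rw [le_div_iff₀ (by positivity)] at this
    linarith
  have hcs : 1 / (2 * (K : ℝ) ^ 2) * s₂ ≤ 1 := by
    have := (h12.trans hδ).trans (min_le_right _ _)
    rw [one_div_mul_eq_div, div_le_one (by positivity)]
    exact this
  set w := s₁ • adjoint T₁ (T₁ z) + s₂ • adjoint T₂ (T₂ z) with hw
  have hs₁ : 0 ≤ s₁ := h0.trans h12
  have hinner : inner ℝ z w = s₁ * ‖T₁ z‖ ^ 2 + s₂ * ‖T₂ z‖ ^ 2 := by
    rw [hw, inner_add_right, inner_smul_right, inner_smul_right, adjoint_inner_right,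
      adjoint_inner_right, real_inner_self_eq_norm_sq, real_inner_self_eq_norm_sq]
  have hwn : ‖w‖ ≤ M * (s₁ * ‖T₁ z‖ + s₂ * ‖T₂ z‖) := by
    calc ‖w‖ ≤ ‖s₁ • adjoint T₁ (T₁ z)‖ + ‖s₂ • adjoint T₂ (T₂ z)‖ := norm_add_le _ _
      _ = s₁ * ‖adjoint T₁ (T₁ z)‖ + s₂ * ‖adjoint T₂ (T₂ z)‖ := by
          rw [norm_smul, norm_smul, Real.norm_of_nonneg hs₁, Real.norm_of_nonneg h0]
      _ ≤ s₁ * (M * ‖T₁ z‖) + s₂ * (M * ‖T₂ z‖) := by gcongr <;> simp only [hMT₁, hMT₂]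
      _ = _ := by ring
  have hw2 : ‖w‖ ^ 2 ≤ s₁ * ‖T₁ z‖ ^ 2 + s₂ * ‖T₂ z‖ ^ 2 := by
    calc ‖w‖ ^ 2 ≤ (M * (s₁ * ‖T₁ z‖ + s₂ * ‖T₂ z‖)) ^ 2 := by gcongr
      _ = M ^ 2 * (s₁ * ‖T₁ z‖ + s₂ * ‖T₂ z‖) ^ 2 := by ring
      _ ≤ M ^ 2 * (2 * ((s₁ * ‖T₁ z‖) ^ 2 + (s₂ * ‖T₂ z‖) ^ 2)) := by
          gcongr
          exact add_sq_le
      _ = 2 * M ^ 2 * s₁ * (s₁ * ‖T₁ z‖ ^ 2) + 2 * M ^ 2 * s₂ * (s₂ * ‖T₂ z‖ ^ 2) := by ring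
      _ ≤ 1 * (s₁ * ‖T₁ z‖ ^ 2) + 1 * (s₂ * ‖T₂ z‖ ^ 2) := by
          gcongr
          exact (by gcongr : 2 * M ^ 2 * s₂ ≤ 2 * M ^ 2 * s₁).trans hδ₁
      _ = _ := by ring
  have hq : s₂ * (‖z‖ ^ 2 / (K : ℝ) ^ 2) ≤ s₁ * ‖T₁ z‖ ^ 2 + s₂ * ‖T₂ z‖ ^ 2 := by
    have : ‖z‖ ^ 2 / (K : ℝ) ^ 2 ≤ ‖T₁ z‖ ^ 2 + ‖T₂ z‖ ^ 2 := by
      rw [div_le_iff₀ (by positivity)]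
      linarith [hbound z]
    calc s₂ * (‖z‖ ^ 2 / (K : ℝ) ^ 2) ≤ s₂ * (‖T₁ z‖ ^ 2 + ‖T₂ z‖ ^ 2) := by gcongr
      _ ≤ s₁ * ‖T₁ z‖ ^ 2 + s₂ * ‖T₂ z‖ ^ 2 := by
          rw [mul_add]
          gcongr
  rw [sub_sub, ← hw]
  refine le_of_sq_le_sq ?_ (mul_nonneg (by linarith) (norm_nonneg _))
  rw [norm_sub_sq_real, hinner]
  have : ((1 - 1 / (2 * (K : ℝ) ^ 2) * s₂) * ‖z‖) ^ 2 =
      ‖z‖ ^ 2 - s₂ * (‖z‖ ^ 2 / (K : ℝ) ^ 2) + (1 / (2 * (K : ℝ) ^ 2) * s₂ * ‖z‖) ^ 2 := by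
    field_simp
    ring
  rw [this]
  nlinarith [sq_nonneg (1 / (2 * (K : ℝ) ^ 2) * s₂ * ‖z‖)]

/-- A recursion driven by two positive operators without common kernel, with vanishing relative
perturbation, tends to zero. -/
theorem tendsto_zero_of_contracting_recursion (T₁ : E →L[ℝ] F₁) (T₂ : E →L[ℝ] F₂)
    (hker : ∀ z, T₁ z = 0 → T₂ z = 0 → z = 0) {s₁ s₂ : ℕ → ℝ}
    (h0 : ∀ t, 0 ≤ s₂ t) (h12 : ∀ᶠ t in atTop, s₂ t ≤ s₁ t) (hs₁ : Tendsto s₁ atTop (𝓝 0))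
    (hsum : ¬ Summable s₂) {z g : ℕ → E} (hg : Tendsto g atTop (𝓝 0))
    (hz : ∀ t, z (t + 1) =
      z t - s₁ t • adjoint T₁ (T₁ (z t)) - s₂ t • adjoint T₂ (T₂ (z t)) + s₂ t • g t) :
    Tendsto z atTop (𝓝 0) := by
  obtain ⟨c, hc, δ, hδ, hcontr⟩ := exists_norm_sub_adjoint_le T₁ T₂ hker
  rw [tendsto_zero_iff_norm_tendsto_zero]
  refine tendsto_zero_of_le_contraction (s := s₂) (ε := fun t => ‖g t‖) hc
    (fun t => norm_nonneg _) h0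
    (tendsto_of_tendsto_of_tendsto_of_le_of_le' tendsto_const_nhds hs₁
      (Eventually.of_forall h0) h12) hsum (tendsto_zero_iff_norm_tendsto_zero.1 hg) ?_
  filter_upwards [h12, hs₁.eventually_le_const hδ] with t ht1 ht2
  rw [hz t]
  refine (norm_add_le _ _).trans (add_le_add (hcontr _ _ (h0 t) ht1 ht2 _) ?_)
  rw [norm_smul, Real.norm_of_nonneg (h0 t)]

/-- Two-time-scale recursion: the noise is split into a part in the range of `T₃†`, invisible to
`T₁`, whose weighted sum converges, and a part in the kernel of `T₃` that is small relative to the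
faster step `s₁`. -/
theorem tendsto_zero_of_two_scale_recursion (T₁ : E →L[ℝ] F₁) (T₂ : E →L[ℝ] F₂)
    (T₃ : E →L[ℝ] F₃) (hker₂ : ∀ z, T₁ z = 0 → T₂ z = 0 → z = 0)
    (hker₃ : ∀ z, T₁ z = 0 → T₃ z = 0 → z = 0) (h13 : ∀ w, T₁ (adjoint T₃ w) = 0)
    {s₁ s₂ : ℕ → ℝ} (h1 : ∀ t, 0 < s₁ t) (h0 : ∀ t, 0 ≤ s₂ t)
    (h12 : ∀ᶠ t in atTop, s₂ t ≤ s₁ t)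
    (hs₁ : Tendsto s₁ atTop (𝓝 0)) (hsum₁ : ¬ Summable s₁) (hsum₂ : ¬ Summable s₂)
    {z g w : ℕ → E} {μ : ℕ → F₃} {l : F₃} (hg : Tendsto g atTop (𝓝 0))
    (hμ : Tendsto (fun k => ∑ t ∈ Finset.range k, s₂ t • μ t) atTop (𝓝 l))
    (hw : Tendsto (fun t => (s₂ t / s₁ t) • w t) atTop (𝓝 0)) (hw₃ : ∀ t, T₃ (w t) = 0)
    (hz : ∀ t, z (t + 1) =
      z t - s₁ t • adjoint T₁ (T₁ (z t)) - s₂ t • adjoint T₂ (T₂ (z t)) +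
        s₂ t • (adjoint T₃ (μ t) + w t + g t)) :
    Tendsto z atTop (𝓝 0) := by
  -- `R` carries the noise in `ker T₃`. The term `T₃† T₃` is fictitious: it makes the recursion
  -- contract at rate `s₁` on all of `E`, yet vanishes along `R`, which never leaves `ker T₃`.
  let R : ℕ → E := fun t => Nat.rec 0 (fun t r =>
    r - s₁ t • adjoint T₁ (T₁ r) - s₁ t • adjoint T₃ (T₃ r) + s₁ t • ((s₂ t / s₁ t) • w t)) t
  have hR : ∀ t, R (t + 1) = R t - s₁ t • adjoint T₁ (T₁ (R t)) - s₁ t • adjoint T₃ (T₃ (R t)) +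
      s₁ t • ((s₂ t / s₁ t) • w t) := fun t => rfl
  have hRlim : Tendsto R atTop (𝓝 0) :=
    tendsto_zero_of_contracting_recursion T₁ T₃ hker₃ (fun t => (h1 t).le)
      (Eventually.of_forall fun t => le_rfl) hs₁ hsum₁ hw hR
  have h31 : ∀ y, T₃ (adjoint T₁ y) = 0 := fun y => by
    refine ext_inner_right ℝ fun v => ?_
    rw [← adjoint_inner_right, adjoint_inner_left, h13, inner_zero_right, inner_zero_left]
  have hR₃ : ∀ t, T₃ (R t) = 0 := by
    intro t
    induction t with
    | zero => exact map_zero T₃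
    | succ t ih => simp [hR, ih, h31, hw₃]
  -- Subtracting the limit keeps the increments and makes the sum tend to zero.
  let S : ℕ → F₃ := fun k => ∑ t ∈ Finset.range k, s₂ t • μ t - l
  have hSlim : Tendsto S atTop (𝓝 0) := by simpa [S] using hμ.sub_const l
  let Q : ℕ → E := fun t => R t + adjoint T₃ (S t)
  have hQlim : Tendsto Q atTop (𝓝 0) := by
    simpa [Q] using hRlim.add (((adjoint T₃).continuous.tendsto 0).comp hSlim)
  have hQ : ∀ t, Q (t + 1) =
      Q t - s₁ t • adjoint T₁ (T₁ (Q t)) + s₂ t • (adjoint T₃ (μ t) + w t) := by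
    intro t
    have hS : S (t + 1) = S t + s₂ t • μ t := by
      simp only [S, Finset.sum_range_succ]
      abel
    have hsw : s₁ t • ((s₂ t / s₁ t) • w t) = s₂ t • w t := by
      rw [smul_smul, mul_div_cancel₀ _ (h1 t).ne']
    simp only [Q, hS, hR, hR₃, hsw, map_add, map_smul, h13, map_zero, smul_zero, add_zero,
      sub_zero, smul_add]
    abel
  have hdiff : Tendsto (fun t => z t - Q t) atTop (𝓝 0) := by
    -- `Q` absorbs all the noise but lacks the `T₂` term, so `z - Q` sees only `g` and the vanishing
    -- `-T₂† T₂ Q`.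
    refine tendsto_zero_of_contracting_recursion T₁ T₂ hker₂ h0 h12 hs₁ hsum₂
      (g := fun t => g t - adjoint T₂ (T₂ (Q t))) ?_ fun t => ?_
    · have := ((adjoint T₂ ∘L T₂).continuous.tendsto 0).comp hQlim
      rw [map_zero] at this
      simpa using hg.sub this
    · rw [hz, hQ]
      simp only [map_sub, smul_sub, smul_add]
      abel
  simpa using hdiff.add hQlim

end Recursion

/-! ### Almost sure convergence of weighted noise series and growth of the noise. -/

section Noise

variable {Ω : Type*} [MeasurableSpace Ω] {P : Measure Ω}

/-- Khinchin–Kolmogorov convergence theorem, for strongly measurable summands. -/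
theorem ae_exists_tendsto_sum_of_stronglyMeasurable [IsProbabilityMeasure P]
    {X : ℕ → Ω → ℝ}
    (hm : ∀ t, StronglyMeasurable (X t)) (hind : iIndepFun X P) (hL2 : ∀ t, MemLp (X t) 2 P)
    (hmean : ∀ t, ∫ ω, X t ω ∂P = 0) (hvar : Summable fun t => variance (X t) P) :
    ∀ᵐ ω ∂P, ∃ c, Tendsto (fun k => ∑ t ∈ Finset.range k, X t ω) atTop (𝓝 c) := by
  let ℱ := Filtration.natural X hm
  -- The sum runs to `k` inclusive, so that `f k` is measurable at time `k` and its next increment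
  -- `X (k + 1)` is independent of the past.
  let f : ℕ → Ω → ℝ := fun k => ∑ t ∈ Finset.range (k + 1), X t
  have hint : ∀ t, Integrable (X t) P := fun t => (hL2 t).integrable one_le_two
  have hf2 : ∀ k, MemLp (f k) 2 P := fun k => memLp_finsetSum' _ fun t _ => hL2 t
  have hf0 : ∀ k, ∫ ω, f k ω ∂P = 0 := fun k => by
    simp only [f, Finset.sum_apply]
    rw [integral_finsetSum _ fun t _ => hint t]
    simp [hmean]
  have hadp : StronglyAdapted ℱ f := fun k =>
    Finset.stronglyMeasurable_sum _ fun t ht =>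
      (Filtration.stronglyAdapted_natural hm t).mono
        (ℱ.mono (Nat.lt_succ_iff.1 (Finset.mem_range.1 ht)))
  have hmart : Martingale f ℱ P := by
    refine martingale_of_condExp_sub_eq_zero_nat hadp (fun k => (hf2 k).integrable one_le_two)
      fun k => ?_
    have : f (k + 1) - f k = X (k + 1) := by
      simp only [f, Finset.sum_range_succ _ (k + 1), add_sub_cancel_left]
    rw [this]
    refine (hind.condExp_natural_ae_eq_of_lt hm (Nat.lt_succ_self k)).trans ?_
    rw [hmean]
    rfl
  -- Martingale convergence needs an `L¹` bound: `|f| ≤ (f² + 1) / 2`, and independence makes the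
  -- variances add.
  have hbdd : ∀ k, eLpNorm (f k) 1 P ≤
      (Real.toNNReal ((∑' t, variance (X t) P + 1) / 2) : NNReal) := by
    intro k
    rw [eLpNorm_one_eq_lintegral_enorm,
      ← ofReal_integral_norm_eq_lintegral_enorm ((hf2 k).integrable one_le_two)]
    refine ENNReal.ofReal_le_ofReal ?_
    have hvk : ∫ ω, f k ω ^ 2 ∂P ≤ ∑' t, variance (X t) P := by
      rw [← variance_of_integral_eq_zero (hf2 k).aemeasurable (hf0 k),
        IndepFun.variance_sum (fun t _ => hL2 t) fun s _ t _ hst => hind.indepFun hst]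
      exact hvar.sum_le_tsum _ fun t _ => variance_nonneg _ _
    calc ∫ ω, ‖f k ω‖ ∂P ≤ ∫ ω, (f k ω ^ 2 + 1) / 2 ∂P := by
          refine integral_mono ((hf2 k).integrable one_le_two).norm
            (((hf2 k).integrable_sq.add (integrable_const 1)).div_const 2) fun ω => ?_
          have := sq_nonneg (‖f k ω‖ - 1)
          have h2 : ‖f k ω‖ ^ 2 = f k ω ^ 2 := by rw [Real.norm_eq_abs, sq_abs]
          simp only
          nlinarith
      _ = (∫ ω, f k ω ^ 2 ∂P + 1) / 2 := by
          rw [integral_div, integral_add (hf2 k).integrable_sq (integrable_const 1)]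
          simp
      _ ≤ _ := by gcongr
  filter_upwards [hmart.submartingale.exists_ae_tendsto_of_bdd hbdd] with ω ⟨c, hc⟩
  refine ⟨c, (tendsto_add_atTop_iff_nat 1).1 ?_⟩
  simpa [f] using hc

/-- Khinchin–Kolmogorov convergence theorem: a series of independent centred random variables
with summable variances converges almost surely. -/
theorem ae_exists_tendsto_sum_of_summable_variance [IsProbabilityMeasure P]
    {X : ℕ → Ω → ℝ} (hind : iIndepFun X P)
    (hL2 : ∀ t, MemLp (X t) 2 P) (hmean : ∀ t, ∫ ω, X t ω ∂P = 0)
    (hvar : Summable fun t => variance (X t) P) :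
    ∀ᵐ ω ∂P, ∃ c, Tendsto (fun k => ∑ t ∈ Finset.range k, X t ω) atTop (𝓝 c) := by
  -- The natural filtration requires strongly measurable variables, hence the modifications.
  let Y : ℕ → Ω → ℝ := fun t => (hL2 t).1.mk (X t)
  have hXY : ∀ t, X t =ᵐ[P] Y t := fun t => (hL2 t).1.ae_eq_mk
  have hY := ae_exists_tendsto_sum_of_stronglyMeasurable
    (fun t => (hL2 t).1.stronglyMeasurable_mk) (hind.congr hXY)
    (fun t => (memLp_congr_ae (hXY t)).1 (hL2 t))
    (fun t => (integral_congr_ae (hXY t)).symm.trans (hmean t))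
    (by simpa only [variance_congr (hXY _)] using hvar)
  filter_upwards [hY, ae_all_iff.2 hXY] with ω hω hXYω
  simpa only [hXYω] using hω

/-- A square-summably weighted series of centred i.i.d. square-integrable random vectors converges
almost surely. -/
theorem ae_exists_tendsto_sum_smul [IsProbabilityMeasure P]
    {p : ℕ} {v : ℕ → Ω → EuclideanSpace ℝ (Fin p)}
    (hind : iIndepFun v P) (hid : ∀ t, IdentDistrib (v t) (v 0) P P)
    (hmean : ∀ t, ∫ ω, v t ω ∂P = 0) (hL2 : MemLp (v 0) 2 P) {α : ℕ → ℝ}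
    (hα : Summable fun t => α t ^ 2) :
    ∀ᵐ ω ∂P, ∃ c, Tendsto (fun k => ∑ t ∈ Finset.range k, α t • v t ω) atTop (𝓝 c) := by
  have hcoord : ∀ j : Fin p, ∀ᵐ ω ∂P, ∃ c,
      Tendsto (fun k => ∑ t ∈ Finset.range k, α t * v t ω j) atTop (𝓝 c) := by
    intro j
    let π : EuclideanSpace ℝ (Fin p) →L[ℝ] ℝ := EuclideanSpace.proj j
    have hcomp : ∀ t, IdentDistrib (fun ω => v t ω j) (fun ω => v 0 ω j) P P := fun t =>
      (hid t).comp (u := π) π.continuous.measurable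
    have h2 : ∀ t, MemLp (v t) 2 P := fun t => (hid t).memLp_iff.2 hL2
    have h2j : ∀ t, MemLp (fun ω => v t ω j) 2 P := fun t => π.comp_memLp' (h2 t)
    refine ae_exists_tendsto_sum_of_summable_variance
      (hind.comp (fun t w => α t * π w) fun t => (π.continuous.measurable.const_mul _))
      (fun t => (h2j t).const_mul (α t)) (fun t => ?_) ?_
    · have : ∫ ω, v t ω j ∂P = π (∫ ω, v t ω ∂P) :=
        π.integral_comp_comm ((h2 t).integrable one_le_two)
      change ∫ ω, α t * v t ω j ∂P = 0
      rw [integral_const_mul]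
      exact mul_eq_zero_of_right _ (this.trans (by rw [hmean, map_zero]))
    · refine (hα.mul_right (variance (fun ω => v 0 ω j) P)).congr fun t => ?_
      rw [← (hcomp t).variance_eq]
      exact (variance_const_mul _ _ _).symm
  filter_upwards [ae_all_iff.2 hcoord] with ω hω
  choose c hc using hω
  refine ⟨WithLp.toLp 2 c, ?_⟩
  have := ((PiLp.continuous_toLp 2 fun _ : Fin p => ℝ).tendsto c).comp (tendsto_pi_nhds.2 hc)
  convert this using 2 with k
  ext j
  simp

/-- Identically distributed random vectors with a finite moment of order `p` are almost surely
`o(t ^ κ)` whenever `κ p > 1`. -/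
theorem ae_tendsto_rpow_neg_mul_norm {E : Type*} [NormedAddCommGroup E] [MeasurableSpace E]
    [BorelSpace E] {v : ℕ → Ω → E} (hid : ∀ t, IdentDistrib (v t) (v 0) P P) {p κ : ℝ}
    (hp : 0 < p) (hκ : 1 < κ * p) (hint : Integrable (fun ω => ‖v 0 ω‖ ^ p) P) :
    ∀ᵐ ω ∂P, Tendsto (fun t : ℕ => ((t : ℝ) + 1) ^ (-κ) * ‖v t ω‖) atTop (𝓝 0) := by
  have hnorm : ∀ t, IdentDistrib (fun ω => ‖v t ω‖ ^ p) (fun ω => ‖v 0 ω‖ ^ p) P P := fun t =>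
    (hid t).comp (u := fun w => ‖w‖ ^ p) (measurable_norm.pow_const p)
  have hsum : Summable fun t : ℕ => ((t : ℝ) + 1) ^ (-κ * p) := by
    have := (summable_nat_add_iff 1).2 (Real.summable_nat_rpow (p := -κ * p) |>.2 (by linarith))
    simpa using this
  -- The sum of these `p`-th powers has finite expectation, so almost surely it is finite and its
  -- terms tend to zero; `p`-th roots finish. Independence plays no role.
  let F : ℕ → Ω → ENNReal := fun t ω =>
    ENNReal.ofReal (((t : ℝ) + 1) ^ (-κ * p)) * ENNReal.ofReal (‖v t ω‖ ^ p)
  have hF : ∀ t, AEMeasurable (F t) P := fun t =>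
    (hnorm t).aemeasurable_fst.ennreal_ofReal.const_mul _
  have hfin : ∫⁻ ω, ∑' t, F t ω ∂P ≠ ⊤ := by
    rw [lintegral_tsum hF]
    have : ∀ t, ∫⁻ ω, F t ω ∂P = ENNReal.ofReal (((t : ℝ) + 1) ^ (-κ * p)) *
        ∫⁻ ω, ENNReal.ofReal (‖v 0 ω‖ ^ p) ∂P := fun t => by
      rw [lintegral_const_mul'' _ (hnorm t).aemeasurable_fst.ennreal_ofReal]
      congr 1
      exact ((hnorm t).comp ENNReal.measurable_ofReal).lintegral_eq
    simp only [this]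
    rw [ENNReal.tsum_mul_right]
    exact ENNReal.mul_ne_top hsum.tsum_ofReal_ne_top hint.lintegral_lt_top.ne
  filter_upwards [ae_lt_top' (AEMeasurable.tsum hF) hfin] with ω hω
  have h1 := ENNReal.tendsto_atTop_zero_of_tsum_ne_top hω.ne
  have h2 := ((ENNReal.tendsto_toReal ENNReal.zero_ne_top).comp h1).rpow_const
    (p := 1 / p) (Or.inr (by positivity))
  rw [ENNReal.toReal_zero, Real.zero_rpow (by positivity)] at h2
  refine h2.congr fun t => ?_
  have ht : (0 : ℝ) < (t : ℝ) + 1 := by positivity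
  simp only [Function.comp_apply, F]
  rw [← ENNReal.ofReal_mul (by positivity), ENNReal.toReal_ofReal (by positivity),
    Real.mul_rpow (by positivity) (by positivity), ← Real.rpow_mul ht.le,
    ← Real.rpow_mul (norm_nonneg _), mul_assoc, mul_one_div_cancel hp.ne', mul_one, Real.rpow_one]

end Noise

/-! ### Observation, edge-difference and summation operators on the network. -/

section Operators

open ContinuousLinearMap

theorem matAct_sub {p q : ℕ} (A : Matrix (Fin p) (Fin q) ℝ) (x y : EuclideanSpace ℝ (Fin q)) :
    matAct A (x - y) = matAct A x - matAct A y := by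
  simp [matAct, Matrix.mulVec_sub]

theorem inner_matAct_transpose {p q : ℕ} (A : Matrix (Fin p) (Fin q) ℝ)
    (x : EuclideanSpace ℝ (Fin p)) (y : EuclideanSpace ℝ (Fin q)) :
    inner ℝ (matAct A.transpose x) y = inner ℝ x (matAct A y) := by
  simp only [matAct, EuclideanSpace.inner_eq_star_dotProduct, star_trivial]
  rw [Matrix.mulVec_transpose, dotProduct_comm, ← Matrix.dotProduct_mulVec, dotProduct_comm]

variable {V : Type*} {n : ℕ}

/-- The stacked observation operator `z ↦ (H_i z_i)_i`. -/
noncomputable def stackObservation {m : V → ℕ} (H : ∀ i, Matrix (Fin (m i)) (Fin n) ℝ) :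
    PiLp 2 (fun _ : V => EuclideanSpace ℝ (Fin n)) →L[ℝ]
      PiLp 2 (fun i => EuclideanSpace ℝ (Fin (m i))) :=
  (PiLp.continuousLinearEquiv 2 ℝ
      (fun i => EuclideanSpace ℝ (Fin (m i)))).symm.toContinuousLinearMap ∘L
    ContinuousLinearMap.pi fun i => LinearMap.toContinuousLinearMap (Matrix.toEuclideanLin (H i)) ∘L
      PiLp.proj 2 (fun _ : V => EuclideanSpace ℝ (Fin n)) i

theorem stackObservation_apply {m : V → ℕ} (H : ∀ i, Matrix (Fin (m i)) (Fin n) ℝ)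
    (z : PiLp 2 (fun _ : V => EuclideanSpace ℝ (Fin n))) (i : V) :
    stackObservation H z i = matAct (H i) (z i) := by
  rfl

/-- The differences of a vertex configuration along the (oriented) edges of a graph. -/
noncomputable def edgeDifference (𝒢 : SimpleGraph V) [DecidableRel 𝒢.Adj] (n : ℕ) :
    PiLp 2 (fun _ : V => EuclideanSpace ℝ (Fin n)) →L[ℝ]
      PiLp 2 (fun _ : V × V => EuclideanSpace ℝ (Fin n)) :=
  (PiLp.continuousLinearEquiv 2 ℝ
      (fun _ : V × V => EuclideanSpace ℝ (Fin n))).symm.toContinuousLinearMap ∘L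
    ContinuousLinearMap.pi fun e => if 𝒢.Adj e.1 e.2 then
      PiLp.proj (𝕜 := ℝ) 2 (fun _ : V => EuclideanSpace ℝ (Fin n)) e.1 -
        PiLp.proj (𝕜 := ℝ) 2 (fun _ : V => EuclideanSpace ℝ (Fin n)) e.2 else 0

/-- The sum of a vertex configuration over all vertices. -/
noncomputable def vertexSum (V : Type*) [Fintype V] (n : ℕ) :
    PiLp 2 (fun _ : V => EuclideanSpace ℝ (Fin n)) →L[ℝ] EuclideanSpace ℝ (Fin n) :=
  ∑ i, PiLp.proj 2 (fun _ : V => EuclideanSpace ℝ (Fin n)) i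

theorem edgeDifference_apply (𝒢 : SimpleGraph V) [DecidableRel 𝒢.Adj]
    (z : PiLp 2 (fun _ : V => EuclideanSpace ℝ (Fin n))) (e : V × V) :
    edgeDifference 𝒢 n z e = if 𝒢.Adj e.1 e.2 then z e.1 - z e.2 else 0 := by
  by_cases h : 𝒢.Adj e.1 e.2 <;> simp [edgeDifference, h]

theorem eq_of_edgeDifference_eq_zero {𝒢 : SimpleGraph V} [DecidableRel 𝒢.Adj]
    (h_conn : 𝒢.Connected) {z : PiLp 2 (fun _ : V => EuclideanSpace ℝ (Fin n))}
    (hz : edgeDifference 𝒢 n z = 0) (i j : V) : z i = z j := by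
  have hadj : ∀ i j, 𝒢.Adj i j → z i = z j := fun i j hij => by
    have h : edgeDifference 𝒢 n z (i, j) = 0 := by rw [hz]; rfl
    rw [edgeDifference_apply, if_pos hij] at h
    exact sub_eq_zero.1 h
  obtain ⟨p⟩ := h_conn.preconnected i j
  induction p with
  | nil => rfl
  | cons h _ ih => exact (hadj _ _ h).trans ih

variable [Fintype V]

theorem vertexSum_apply (z : PiLp 2 (fun _ : V => EuclideanSpace ℝ (Fin n))) :
    vertexSum V n z = ∑ i, z i := by
  simp [vertexSum]

theorem adjoint_vertexSum (u : EuclideanSpace ℝ (Fin n)) :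
    adjoint (vertexSum V n) u = WithLp.toLp 2 fun _ => u := by
  refine ext_inner_right ℝ fun y => ?_
  rw [adjoint_inner_left, vertexSum_apply, inner_sum, PiLp.inner_apply]

theorem adjoint_stackObservation {m : V → ℕ} (H : ∀ i, Matrix (Fin (m i)) (Fin n) ℝ)
    (w : PiLp 2 (fun i => EuclideanSpace ℝ (Fin (m i)))) :
    adjoint (stackObservation H) w = WithLp.toLp 2 fun i => matAct (H i).transpose (w i) := by
  refine ext_inner_right ℝ fun y => ?_
  rw [adjoint_inner_left, PiLp.inner_apply, PiLp.inner_apply]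
  simp only [stackObservation_apply, inner_matAct_transpose]

/-- The graph Laplacian, up to the factor `2` from counting each edge in both directions. -/
theorem adjoint_edgeDifference (𝒢 : SimpleGraph V) [DecidableRel 𝒢.Adj]
    (z : PiLp 2 (fun _ : V => EuclideanSpace ℝ (Fin n))) :
    adjoint (edgeDifference 𝒢 n) (edgeDifference 𝒢 n z) =
      WithLp.toLp 2 fun i => (2 : ℝ) • ∑ j ∈ 𝒢.neighborFinset i, (z i - z j) := by
  refine ext_inner_right ℝ fun y => ?_
  rw [adjoint_inner_left, PiLp.inner_apply, PiLp.inner_apply, Fintype.sum_prod_type]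
  have hnb : ∀ i, ∑ j ∈ 𝒢.neighborFinset i, (z i - z j) =
      ∑ j, if 𝒢.Adj i j then z i - z j else 0 := fun i => by
    rw [← Finset.sum_filter]
    congr 1
    ext j
    simp
  -- Each edge term splits between its two endpoints; exchanging `i` and `j` turns the second half
  -- into the first, whence the factor `2`.
  have h1 : ∀ i j, inner ℝ (edgeDifference 𝒢 n z (i, j)) (edgeDifference 𝒢 n y (i, j)) =
      inner ℝ (if 𝒢.Adj i j then z i - z j else 0) (y i) +
        inner ℝ (if 𝒢.Adj j i then z j - z i else 0) (y j) := fun i j => by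
    simp only [edgeDifference_apply]
    by_cases h : 𝒢.Adj i j
    · simp only [h, h.symm, if_true, inner_sub_left, inner_sub_right]
      ring
    · have h' : ¬ 𝒢.Adj j i := fun h' => h h'.symm
      simp [h, h']
  simp only [h1, Finset.sum_add_distrib]
  rw [Finset.sum_comm (f := fun i j => inner ℝ (if 𝒢.Adj j i then z j - z i else 0) (y j))]
  simp only [← sum_inner, hnb, inner_smul_left]
  rw [← Finset.mul_sum]
  simp [two_mul]

theorem edgeDifference_adjoint_vertexSum (𝒢 : SimpleGraph V) [DecidableRel 𝒢.Adj]
    (u : EuclideanSpace ℝ (Fin n)) :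
    edgeDifference 𝒢 n (adjoint (vertexSum V n) u) = 0 := by
  rw [adjoint_vertexSum]
  ext e : 1
  simp [edgeDifference_apply]

theorem eq_zero_of_edgeDifference_of_vertexSum {𝒢 : SimpleGraph V} [DecidableRel 𝒢.Adj]
    (h_conn : 𝒢.Connected) (z : PiLp 2 (fun _ : V => EuclideanSpace ℝ (Fin n)))
    (hz : edgeDifference 𝒢 n z = 0) (hs : vertexSum V n z = 0) : z = 0 := by
  have : Nonempty V := h_conn.nonempty
  ext i : 1
  rw [vertexSum_apply, Finset.sum_congr rfl fun j _ => eq_of_edgeDifference_eq_zero h_conn hz j i,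
    Finset.sum_const, Finset.card_univ, ← Nat.cast_smul_eq_nsmul ℝ] at hs
  exact (smul_eq_zero.1 hs).resolve_left (Nat.cast_ne_zero.2 Fintype.card_ne_zero)

/-- A consensus configuration with common value `u` that is unobserved by every agent satisfies `(∑
HᵢᵀHᵢ) u = 0`, so full rank forces `u = 0`. -/
theorem eq_zero_of_edgeDifference_of_stackObservation {𝒢 : SimpleGraph V} [DecidableRel 𝒢.Adj]
    {m : V → ℕ} {H : ∀ i, Matrix (Fin (m i)) (Fin n) ℝ} (h_conn : 𝒢.Connected)
    (h_obs : (∑ i, (H i).transpose * H i).rank = n)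
    (z : PiLp 2 (fun _ : V => EuclideanSpace ℝ (Fin n)))
    (hz : edgeDifference 𝒢 n z = 0) (hH : stackObservation H z = 0) : z = 0 := by
  ext i : 1
  have hHi : ∀ j, (H j).mulVec (z i).ofLp = 0 := fun j => by
    have h : stackObservation H z j = 0 := by rw [hH]; rfl
    rw [stackObservation_apply, eq_of_edgeDifference_eq_zero h_conn hz j i] at h
    exact congrArg WithLp.ofLp h
  have hzero : (∑ j, (H j).transpose * H j).mulVecLin (z i).ofLp = 0 := by
    rw [Matrix.mulVecLin_apply, Matrix.sum_mulVec]
    exact Finset.sum_eq_zero fun j _ => by rw [← Matrix.mulVec_mulVec, hHi, Matrix.mulVec_zero]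
  have hsurj : Function.Surjective (∑ j, (H j).transpose * H j).mulVecLin := by
    rw [← LinearMap.range_eq_top]
    refine Submodule.eq_top_of_finrank_eq ?_
    rw [Module.finrank_fin_fun]
    exact h_obs
  have hinj := LinearMap.injective_iff_surjective.2 hsurj
  exact congrArg (WithLp.toLp 2) (hinj (hzero.trans (map_zero _).symm))

end Operators

/-! ### Deterministic convergence of consensus plus innovations. -/

section Consensus

open ContinuousLinearMap

variable {V : Type*} [Fintype V] {n : ℕ}

/-- Deterministic convergence of consensus plus innovations: if the weighted noise series
converge, the noise is small relative to the consensus step, and the remaining perturbation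
vanishes relative to the innovation step, then the errors tend to zero. -/
theorem tendsto_zero_of_consensus_innovation {𝒢 : SimpleGraph V} [DecidableRel 𝒢.Adj]
    {m : V → ℕ} {H : ∀ i, Matrix (Fin (m i)) (Fin n) ℝ} (h_conn : 𝒢.Connected)
    (h_obs : (∑ i, (H i).transpose * H i).rank = n) {α β : ℕ → ℝ}
    (hα : ∀ t, 0 ≤ α t) (hβ : ∀ t, 0 < β t) (hαβ : Tendsto (fun t => α t / β t) atTop (𝓝 0))
    (hβ0 : Tendsto β atTop (𝓝 0)) (hαsum : ¬ Summable α) (hβsum : ¬ Summable β)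
    {z g : V → ℕ → EuclideanSpace ℝ (Fin n)} {v : ∀ i, ℕ → EuclideanSpace ℝ (Fin (m i))}
    (hvsum : ∀ i, ∃ c, Tendsto (fun k => ∑ t ∈ Finset.range k, α t • v i t) atTop (𝓝 c))
    (hv : ∀ i, Tendsto (fun t => (α t / β t) • v i t) atTop (𝓝 0))
    (hg : ∀ i, Tendsto (g i) atTop (𝓝 0))
    (hz : ∀ i t, z i (t + 1) = z i t + β t • ∑ j ∈ 𝒢.neighborFinset i, (z j t - z i t) -
      α t • matAct (H i).transpose (matAct (H i) (z i t)) +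
        α t • (matAct (H i).transpose (v i t) + g i t)) (i : V) :
    Tendsto (z i) atTop (𝓝 0) := by
  have : Nonempty V := h_conn.nonempty
  let T₂ := stackObservation H
  let T₃ := vertexSum V n
  let Z : ℕ → PiLp 2 (fun _ : V => EuclideanSpace ℝ (Fin n)) := fun t =>
    WithLp.toLp 2 fun i => z i t
  let G : ℕ → PiLp 2 (fun _ : V => EuclideanSpace ℝ (Fin n)) := fun t =>
    WithLp.toLp 2 fun i => g i t
  let N : ℕ → PiLp 2 (fun i => EuclideanSpace ℝ (Fin (m i))) := fun t =>
    WithLp.toLp 2 fun i => v i t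
  -- Since `T₃ T₃†` is multiplication by `|V|`, `T₃† B` is the projection of `T₂†` onto constant
  -- configurations; `C` is the remaining disagreement part, with `T₃ C = 0`.
  let B := (Fintype.card V : ℝ)⁻¹ • (T₃ ∘L adjoint T₂)
  let C := adjoint T₂ - adjoint T₃ ∘L B
  have hGlim : Tendsto G atTop (𝓝 0) :=
    ((PiLp.continuous_toLp 2 _).tendsto 0).comp (tendsto_pi_nhds.2 hg)
  choose c hc using hvsum
  have hNsum : Tendsto (fun k => ∑ t ∈ Finset.range k, α t • N t) atTop
      (𝓝 (WithLp.toLp 2 c)) := by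
    have := ((PiLp.continuous_toLp 2 fun i => EuclideanSpace ℝ (Fin (m i))).tendsto c).comp
      (tendsto_pi_nhds.2 hc)
    refine this.congr fun k => ?_
    ext i : 1
    simp [N]
  -- The consensus step is `β / 2` because `adjoint_edgeDifference` is twice the Laplacian.
  have hNlim : Tendsto (fun t => (α t / (β t / 2)) • N t) atTop (𝓝 0) := by
    have h1 : ∀ i, Tendsto (fun t => (α t / (β t / 2)) • v i t) atTop (𝓝 0) := fun i => by
      have := (hv i).const_smul (2 : ℝ)
      rw [smul_zero] at this
      refine this.congr fun t => ?_
      rw [smul_smul]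
      congr 1
      have := (hβ t).ne'
      field_simp
    exact ((PiLp.continuous_toLp 2 _).tendsto 0).comp (tendsto_pi_nhds.2 h1)
  have hZ : Tendsto Z atTop (𝓝 0) := by
    refine tendsto_zero_of_two_scale_recursion (edgeDifference 𝒢 n) T₂ T₃
      (eq_zero_of_edgeDifference_of_stackObservation h_conn h_obs)
      (eq_zero_of_edgeDifference_of_vertexSum h_conn) (edgeDifference_adjoint_vertexSum 𝒢)
      (s₁ := fun t => β t / 2) (s₂ := α) (g := G) (w := fun t => C (N t)) (μ := fun t => B (N t))
      (l := B (WithLp.toLp 2 c))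
      (fun t => half_pos (hβ t)) hα ?_ (by simpa using hβ0.div_const 2) ?_ hαsum hGlim
      ?_ ?_ ?_ ?_
    · filter_upwards [hαβ.eventually_le_const (show (0 : ℝ) < 1 / 2 by norm_num)] with t ht
      rw [div_le_iff₀ (hβ t)] at ht
      linarith
    · intro h
      exact hβsum (by simpa using h.mul_right 2)
    · simpa only [Function.comp_def, map_sum, map_smul] using (B.continuous.tendsto _).comp hNsum
    · have := (C.continuous.tendsto _).comp hNlim
      simpa only [Function.comp_def, map_smul, map_zero] using this
    · intro t
      have h33 : ∀ u, T₃ (adjoint T₃ u) = (Fintype.card V : ℝ) • u := fun u => by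
        rw [adjoint_vertexSum, vertexSum_apply]
        simp [← Nat.cast_smul_eq_nsmul ℝ]
      have hcard : (Fintype.card V : ℝ) ≠ 0 := Nat.cast_ne_zero.2 Fintype.card_ne_zero
      simp [C, B, h33, smul_smul, hcard]
    · intro t
      have hCB : adjoint T₃ (B (N t)) + C (N t) = adjoint T₂ (N t) := by simp [C]
      rw [hCB, adjoint_edgeDifference, adjoint_stackObservation, adjoint_stackObservation]
      ext i : 1
      have hneg : ∑ j ∈ 𝒢.neighborFinset i, (z j t - z i t) =
          -∑ j ∈ 𝒢.neighborFinset i, (z i t - z j t) := by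
        rw [← Finset.sum_neg_distrib]
        simp
      simp only [Z, G, N, T₂, PiLp.add_apply, PiLp.sub_apply, PiLp.smul_apply,
        stackObservation_apply, hz, hneg, smul_smul, smul_neg, div_mul_cancel₀ _ (two_ne_zero' ℝ)]
      abel
  exact ((PiLp.proj 2 (𝕜 := ℝ) (fun _ : V => EuclideanSpace ℝ (Fin n)) i).continuous.tendsto
    0).comp hZ

end Consensus

/-! ### Communication errors caused by event triggering. -/

section Trigger

variable {n : ℕ}

/-- Either the agent sends now and the error is zero, or the trigger stays silent, which is exactly
the bound. -/
theorem norm_latestTrigger_sub_le (ρ : ℝ) (x : ℕ → EuclideanSpace ℝ (Fin n)) (t : ℕ) :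
    ‖x (latestTrigger ρ x t) - x t‖ ≤ polyStep 1 ρ t := by
  have hpos : 0 ≤ polyStep 1 ρ t := by
    unfold polyStep
    positivity
  cases t with
  | zero => simpa [latestTrigger] using hpos
  | succ t =>
    rw [latestTrigger]
    split_ifs with h
    · simpa using hpos
    · rw [norm_sub_rev]
      exact not_lt.1 h

variable {V : Type*} [Fintype V] {𝒢 : SimpleGraph V} [DecidableRel 𝒢.Adj] {m : V → ℕ}
  {H : ∀ i, Matrix (Fin (m i)) (Fin n) ℝ} {α β : ℕ → ℝ} {ρ : V → ℝ}
  {y : ∀ i, ℕ → EuclideanSpace ℝ (Fin (m i))} {x : V → ℕ → EuclideanSpace ℝ (Fin n)}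

/-- Both forms of the estimator are a consensus plus innovations recursion with communication
errors bounded by the triggering thresholds. -/
theorem exists_communication_error
    (hx : IsEventTriggeredEstimator 𝒢 H α β ρ y x ∨
      IsEventTriggeredEstimatorStored 𝒢 H α β ρ y x) :
    ∃ r : V → V → ℕ → EuclideanSpace ℝ (Fin n),
      (∀ i j t, ‖r i j t‖ ≤ polyStep 1 (ρ j) t) ∧
      ∀ i t, x i (t + 1) = x i t + β t • ∑ j ∈ 𝒢.neighborFinset i, (x j t - x i t) +
        α t • matAct (H i).transpose (y i t - matAct (H i) (x i t)) +
        β t • ∑ j ∈ 𝒢.neighborFinset i, r i j t := by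
  rcases hx with hx | hx
  -- In the original form the indicator, which is `0` or `1`, multiplies the stored-value error and
  -- cannot enlarge it.
  · refine ⟨fun i j t => triggerIndicator (ρ i) (x i) t •
      (x j (latestTrigger (ρ j) (x j) t) - x j t), fun i j t => ?_, fun i t => ?_⟩
    · refine le_trans ?_ (norm_latestTrigger_sub_le (ρ j) (x j) t)
      rw [norm_smul]
      refine mul_le_of_le_one_left (norm_nonneg _) ?_
      unfold triggerIndicator
      split_ifs <;> simp
    · rw [hx i t]
      have : ∑ j ∈ 𝒢.neighborFinset i,
          (triggerIndicator (ρ i) (x i) t • x j (latestTrigger (ρ j) (x j) t) +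
            (1 - triggerIndicator (ρ i) (x i) t) • x j t - x i t) =
          ∑ j ∈ 𝒢.neighborFinset i, (x j t - x i t) + ∑ j ∈ 𝒢.neighborFinset i,
            triggerIndicator (ρ i) (x i) t • (x j (latestTrigger (ρ j) (x j) t) - x j t) := by
        rw [← Finset.sum_add_distrib]
        refine Finset.sum_congr rfl fun j _ => ?_
        module
      rw [this, smul_add]
      abel
  · exact ⟨fun i j t => x j (latestTrigger (ρ j) (x j) t) - x j t,
      fun i j t => norm_latestTrigger_sub_le (ρ j) (x j) t, hx⟩

end Trigger

/-! ### Asymptotics of polynomial step sizes. -/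

section PolyStep

theorem polyStep_pos {c : ℝ} (hc : 0 < c) (τ : ℝ) (t : ℕ) : 0 < polyStep c τ t := by
  unfold polyStep
  positivity

theorem polyStep_eq (c τ : ℝ) (t : ℕ) : polyStep c τ t = c * ((t : ℝ) + 1) ^ (-τ) := by
  rw [polyStep, Real.rpow_neg (by positivity), div_eq_mul_inv]

theorem tendsto_natCast_add_one_rpow_neg {τ : ℝ} (hτ : 0 < τ) :
    Tendsto (fun t : ℕ => ((t : ℝ) + 1) ^ (-τ)) atTop (𝓝 0) :=
  (tendsto_rpow_neg_atTop hτ).comp (tendsto_natCast_atTop_atTop.atTop_add tendsto_const_nhds)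

theorem tendsto_polyStep (c : ℝ) {τ : ℝ} (hτ : 0 < τ) :
    Tendsto (polyStep c τ) atTop (𝓝 0) := by
  simpa [← polyStep_eq] using (tendsto_natCast_add_one_rpow_neg hτ).const_mul c

theorem summable_natCast_add_one_rpow_neg {τ : ℝ} :
    Summable (fun t : ℕ => ((t : ℝ) + 1) ^ (-τ)) ↔ 1 < τ := by
  have h := (summable_nat_add_iff 1).trans (Real.summable_nat_rpow (p := -τ))
  simp only [Nat.cast_add, Nat.cast_one] at h
  rw [h, neg_lt_neg_iff]

theorem not_summable_polyStep {c τ : ℝ} (hc : 0 < c) (hτ : τ ≤ 1) :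
    ¬ Summable (polyStep c τ) := by
  intro h
  rw [show polyStep c τ = fun t : ℕ => c * ((t : ℝ) + 1) ^ (-τ) from funext (polyStep_eq c τ),
    summable_mul_left_iff hc.ne', summable_natCast_add_one_rpow_neg] at h
  exact absurd h (not_lt.2 hτ)

theorem summable_polyStep_sq (c : ℝ) {τ : ℝ} (hτ : 1 / 2 < τ) :
    Summable fun t => polyStep c τ t ^ 2 := by
  refine ((summable_natCast_add_one_rpow_neg.2 (by linarith : 1 < τ * 2)).mul_left
    (c ^ 2)).congr fun t => ?_
  have ht : (0 : ℝ) ≤ (t : ℝ) + 1 := by positivity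
  rw [polyStep_eq, mul_pow, ← Real.rpow_mul_natCast ht]
  norm_num

theorem polyStep_div_polyStep (c d σ τ : ℝ) (t : ℕ) :
    polyStep c σ t / polyStep d τ t = c / d * ((t : ℝ) + 1) ^ (-(σ - τ)) := by
  have ht : (0 : ℝ) < (t : ℝ) + 1 := by positivity
  rw [polyStep_eq, polyStep_eq, mul_div_mul_comm, ← Real.rpow_sub ht]
  ring_nf

end PolyStep

/-! ### Pathwise consistency and the almost sure conclusion. -/

/-- Pathwise consistency: on every sample path along which the weighted noise series converge and
the noise is `o(t ^ (τ₁ - τ₂))`, the estimates tend to the parameter. -/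
theorem tendsto_of_eventTriggered {V : Type*} [Fintype V] {𝒢 : SimpleGraph V}
    [DecidableRel 𝒢.Adj] {n : ℕ} {m : V → ℕ} {H : ∀ i, Matrix (Fin (m i)) (Fin n) ℝ}
    {θ : EuclideanSpace ℝ (Fin n)} {v : ∀ i, ℕ → EuclideanSpace ℝ (Fin (m i))} {ρ : V → ℝ}
    {a b τ₁ τ₂ : ℝ} {x : V → ℕ → EuclideanSpace ℝ (Fin n)} (h_conn : 𝒢.Connected)
    (h_obs : (∑ i, (H i).transpose * H i).rank = n) (ha : 0 < a) (hb : 0 < b) (hτ₂ : 0 < τ₂)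
    (hτ₂₁ : τ₂ < τ₁) (hτ₁ : τ₁ ≤ 1) (hρ : ∀ i, τ₁ - τ₂ < ρ i)
    (hvsum : ∀ i, ∃ c,
      Tendsto (fun k => ∑ t ∈ Finset.range k, polyStep a τ₁ t • v i t) atTop (𝓝 c))
    (hv : ∀ i, Tendsto (fun t : ℕ => ((t : ℝ) + 1) ^ (-(τ₁ - τ₂)) * ‖v i t‖) atTop (𝓝 0))
    (hx : IsEventTriggeredEstimator 𝒢 H (polyStep a τ₁) (polyStep b τ₂) ρ
        (fun i t => observe (H i) θ (v i t)) x ∨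
      IsEventTriggeredEstimatorStored 𝒢 H (polyStep a τ₁) (polyStep b τ₂) ρ
        (fun i t => observe (H i) θ (v i t)) x) (i : V) :
    Tendsto (x i) atTop (𝓝 θ) := by
  obtain ⟨r, hr, hrec⟩ := exists_communication_error hx
  have hratio : ∀ j, Tendsto (fun t => (polyStep b τ₂ t / polyStep a τ₁ t) * polyStep 1 (ρ j) t)
      atTop (𝓝 0) := fun j => by
    have := (tendsto_natCast_add_one_rpow_neg
      (show 0 < ρ j - (τ₁ - τ₂) by linarith [hρ j])).const_mul (b / a)
    rw [mul_zero] at this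
    refine this.congr fun t => ?_
    rw [polyStep_div_polyStep, polyStep_eq 1, one_mul, mul_assoc,
      ← Real.rpow_add (by positivity)]
    ring_nf
  -- The communication error, of weight `β`, is rewritten as a perturbation of weight `α`.
  let g : V → ℕ → EuclideanSpace ℝ (Fin n) := fun i t =>
    (polyStep b τ₂ t / polyStep a τ₁ t) • ∑ j ∈ 𝒢.neighborFinset i, r i j t
  have hg : ∀ i, Tendsto (g i) atTop (𝓝 0) := fun i => by
    have hterm : ∀ j ∈ 𝒢.neighborFinset i,
        Tendsto (fun t => (polyStep b τ₂ t / polyStep a τ₁ t) • r i j t) atTop (𝓝 0) :=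
      fun j _ => squeeze_zero_norm (fun t => by
        have : 0 ≤ polyStep b τ₂ t / polyStep a τ₁ t :=
          (div_pos (polyStep_pos hb _ _) (polyStep_pos ha _ _)).le
        rw [norm_smul, Real.norm_of_nonneg this]
        exact mul_le_mul_of_nonneg_left (hr i j t) this) (hratio j)
    simpa only [g, Finset.smul_sum, Finset.sum_const_zero] using tendsto_finsetSum _ hterm
  have hκ : 0 < τ₁ - τ₂ := sub_pos.2 hτ₂₁
  have hz := tendsto_zero_of_consensus_innovation (z := fun i t => x i t - θ) (g := g) (v := v)
    h_conn h_obs (fun t => (polyStep_pos ha τ₁ t).le) (polyStep_pos hb τ₂)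
    (by
      simp only [polyStep_div_polyStep]
      simpa using (tendsto_natCast_add_one_rpow_neg hκ).const_mul (a / b))
    (tendsto_polyStep b hτ₂) (not_summable_polyStep ha hτ₁)
    (not_summable_polyStep hb (hτ₂₁.le.trans hτ₁)) hvsum
    (fun i => by
      rw [tendsto_zero_iff_norm_tendsto_zero]
      have := (hv i).const_mul (a / b)
      rw [mul_zero] at this
      refine this.congr fun t => ?_
      rw [norm_smul, polyStep_div_polyStep, Real.norm_of_nonneg (by positivity), mul_assoc])
    hg
    (fun i t => by
      have hcancel : polyStep a τ₁ t * (polyStep b τ₂ t / polyStep a τ₁ t) = polyStep b τ₂ t :=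
        mul_div_cancel₀ _ (polyStep_pos ha τ₁ t).ne'
      have hobs : observe (H i) θ (v i t) - matAct (H i) (x i t) =
          v i t - matAct (H i) (x i t - θ) := by
        rw [observe, matAct_sub]
        abel
      simp only [hrec, hobs, g, smul_add, smul_smul, hcancel, sub_sub_sub_cancel_right]
      rw [matAct_sub _ (v i t), smul_sub]
      abel) i
  simpa using hz.add_const θ

theorem mainTheorem2
    {V : Type*} [Fintype V] (𝒢 : SimpleGraph V) [DecidableRel 𝒢.Adj]
    {n : ℕ} {m : V → ℕ}
    (H : ∀ i, Matrix (Fin (m i)) (Fin n) ℝ) (θ : EuclideanSpace ℝ (Fin n))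
    {Ω : Type*} [MeasurableSpace Ω] (P : Measure Ω) [IsProbabilityMeasure P]
    (v : ∀ i, ℕ → Ω → EuclideanSpace ℝ (Fin (m i)))
    (ρ : V → ℝ) (a b τ₁ τ₂ ε₁ : ℝ)
    (x : V → ℕ → Ω → EuclideanSpace ℝ (Fin n))
    -- the noise of each agent is i.i.d. in time with zero mean
    (hv_indep : ∀ i, iIndepFun (v i) P)
    (hv_ident : ∀ i t, IdentDistrib (v i t) (v i 0) P P)
    (hv_mean : ∀ i t, ∫ ω, v i t ω ∂P = 0)
    -- connected graph, collective observability
    (h_conn : 𝒢.Connected)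
    (h_obs : (∑ i, (H i).transpose * H i).rank = n)
    -- moment bound on the stacked noise
    (hε₁ : 0 < ε₁)
    (hv_moment : ∀ t, Integrable (fun ω => ‖stackNoise (fun i => v i t ω)‖ ^ (2 + ε₁)) P)
    -- step sizes
    (ha : 0 < a) (hb : 0 < b) (hτ₂ : 0 < τ₂) (hτ₂₁ : τ₂ ≤ τ₁) (hτ₁ : τ₁ ≤ 1)
    (hτ : max (τ₂ + 1 / (2 + ε₁)) (1 / 2) < τ₁)
    -- triggering thresholds
    (hρ : ∀ i, 0 < ρ i) (hρ₀ : τ₁ - τ₂ < ⨅ j, ρ j)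
    -- the estimates are produced by the algorithm, in its original or its rewritten form
    (hx : (∀ ω, IsEventTriggeredEstimator 𝒢 H (polyStep a τ₁) (polyStep b τ₂) ρ
              (fun i t => observe (H i) θ (v i t ω)) (fun i t => x i t ω)) ∨
          (∀ ω, IsEventTriggeredEstimatorStored 𝒢 H (polyStep a τ₁) (polyStep b τ₂) ρ
              (fun i t => observe (H i) θ (v i t ω)) (fun i t => x i t ω))) :
    ∀ i, ∀ᵐ ω ∂P, Tendsto (fun t => x i t ω) atTop (𝓝 θ) := by
  have hp : 0 < 2 + ε₁ := by linarith
  obtain ⟨hτκ, hτhalf⟩ := max_lt_iff.1 hτ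
  have hκ : 1 / (2 + ε₁) < τ₁ - τ₂ := by linarith
  have hκp : 1 < (τ₁ - τ₂) * (2 + ε₁) := (div_lt_iff₀ hp).1 hκ
  -- The moment condition makes the gap between the two time scales strict.
  have hτlt : τ₂ < τ₁ := sub_pos.1 ((one_div_pos.2 hp).trans hκ)
  have hρlt : ∀ i, τ₁ - τ₂ < ρ i := fun i =>
    hρ₀.trans_le (ciInf_le (Set.finite_range ρ).bddBelow i)
  have hmoment : ∀ i, Integrable (fun ω => ‖v i 0 ω‖ ^ (2 + ε₁)) P := fun i => by
    refine (hv_moment 0).mono'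
      ((hv_ident i 0).aemeasurable_fst.norm.pow_const _).aestronglyMeasurable
      (Eventually.of_forall fun ω => ?_)
    rw [Real.norm_of_nonneg (by positivity)]
    gcongr
    exact PiLp.norm_apply_le (stackNoise fun i => v i 0 ω) i
  have hL2 : ∀ i, MemLp (v i 0) 2 P := fun i => by
    have hmeas := (hv_ident i 0).aemeasurable_fst.aestronglyMeasurable
    have h : MemLp (v i 0) (ENNReal.ofReal (2 + ε₁)) P := by
      rw [← integrable_norm_rpow_iff hmeas (by simpa using hp) ENNReal.ofReal_ne_top,
        ENNReal.toReal_ofReal hp.le]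
      exact hmoment i
    refine h.mono_exponent ?_
    rw [← ENNReal.ofReal_ofNat 2]
    exact ENNReal.ofReal_le_ofReal (by linarith)
  have hsum : ∀ᵐ ω ∂P, ∀ i, ∃ c,
      Tendsto (fun k => ∑ t ∈ Finset.range k, polyStep a τ₁ t • v i t ω) atTop (𝓝 c) :=
    ae_all_iff.2 fun i => ae_exists_tendsto_sum_smul (hv_indep i) (hv_ident i) (hv_mean i) (hL2 i)
      (summable_polyStep_sq a hτhalf)
  have hsmall : ∀ᵐ ω ∂P, ∀ i,
      Tendsto (fun t : ℕ => ((t : ℝ) + 1) ^ (-(τ₁ - τ₂)) * ‖v i t ω‖) atTop (𝓝 0) :=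
    ae_all_iff.2 fun i => ae_tendsto_rpow_neg_mul_norm (hv_ident i) hp hκp (hmoment i)
  intro i
  filter_upwards [hsum, hsmall] with ω h1 h2
  exact tendsto_of_eventTriggered h_conn h_obs ha hb hτ₂ hτlt hτ₁ hρlt h1 h2
    (hx.imp (fun h => h ω) fun h => h ω) i
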